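/- Let $M$ be a second countable Hausdorff $C^\infty$ manifold of dimension $n$, and let $TM\setminus\{0\}$ be its tangent bundle $\pi:TM\to M$ with the zero section removed; functions, forms and vector fields below are $C^\infty$ on $TM\setminus\{0\}$. Let $\mathbb C(u)=\frac{d}{ds}\big|_{0}(u+su)$ be the Liouville vector field and $J(\xi)=\frac{d}{dt}\big|_{0}(u+t\,D\pi(\xi))$, $\xi\in T_u(TM)$, the tangent structure. For a $p$-form $\alpha$ with $p\ge 1$ put $(i_J\alpha)(X_1,\dots,X_p)=\sum_i\alpha(X_1,\dots,JX_i,\dots,X_p)$, put $i_Jf=0$ for functions, and let $d_J=i_J\circ d-d\circ i_J$. A form $\alpha$ is $d_J$-closed if $d_J\alpha=0$; a $1$-form is $d_J$-exact if it equals $d_Jf$ for some $f\in C^\infty(TM\setminus\{0\})$, and semi-basic if it vanishes on all vectors $\xi$ with $D\pi(\xi)=0$. For $m\in\mathbb Z$, a function $f$ is $m$-homogeneous if $f(\lambda y)=\lambda^m f(y)$ for all $\lambda>0$ and $y\in TM\setminus\{0\}$, and a $1$-form $\theta$ is $m$-homogeneous if $\mathcal L_{\mathbb C}\theta=m\theta$.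 A spray is a vector field $S$ on $TM\setminus\{0\}$ with $JS=\mathbb C$ and $[\mathbb C,S]=S$. Let $k$ be an integer. (i) If $L\in C^\infty(TM\setminus\{0\})$ is $k$-homogeneous, then the Poincaré–Cartan form $d_JL$ is a (smooth) $1$-form on $TM\setminus\{0\}$ that is semi-basic, $d_J$-closed and $(k-1)$-homogeneous. (ii) If $k\neq 0$ and $\theta$ is a semi-basic, $d_J$-closed, $(k-1)$-homogeneous $1$-form on $TM\setminus\{0\}$, then $\theta$ is $d_J$-exact. Moreover, for every spray $S$ on $M$, the function $L=\frac1k\, i_S\theta$ is the unique $k$-homogeneous function $L\in C^\infty(TM\setminus\{0\})$ such that $\theta=d_JL$. -/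

import Mathlib

open Set Bundle
open scoped Manifold ContDiff

noncomputable section

namespace SlitTangent

/-- `TM`, the total space of the tangent bundle of the `n`-dimensional manifold `M`. -/
abbrev TM (n : ℕ) (M : Type*) [TopologicalSpace M]
    [ChartedSpace (EuclideanSpace ℝ (Fin n)) M] [IsManifold (𝓡 n) ∞ M] : Type _ :=
  TangentBundle (𝓡 n) M

/-- The model vector space of `TM`, with coordinates `(x, y)`. -/
abbrev ModelTM (n : ℕ) : Type :=
  EuclideanSpace ℝ (Fin n) × EuclideanSpace ℝ (Fin n)

variable {n : ℕ} {M : Type*} [TopologicalSpace M]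
  [ChartedSpace (EuclideanSpace ℝ (Fin n)) M] [IsManifold (𝓡 n) ∞ M]

/-- `TM ∖ {0}`: the tangent bundle with the zero section removed. It is an open subset of `TM`.
Objects on `TM ∖ {0}` are represented by objects on `TM` whose values on the zero section
are irrelevant: smoothness and all identities are only ever required on `slit n M`. -/
def slit (n : ℕ) (M : Type*) [TopologicalSpace M]
    [ChartedSpace (EuclideanSpace ℝ (Fin n)) M] [IsManifold (𝓡 n) ∞ M] : Set (TM n M) :=
  {u | u.snd ≠ 0}

/-- The tangent space `T_u TM`. -/
abbrev TTM (u : TM n M) : Type := TangentSpace (𝓡 n).tangent u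

variable (n M) in
/-- (Not necessarily smooth) vector fields. -/
abbrev VField : Type _ := (u : TM n M) → TTM u

variable (n M) in
/-- (Not necessarily smooth) `1`-forms. -/
abbrev OneForm : Type _ := (u : TM n M) → (TTM u →L[ℝ] ℝ)

variable (n M) in
/-- (Not necessarily smooth) `2`-forms. -/
abbrev TwoForm : Type _ := (u : TM n M) → (TTM u [⋀^Fin 2]→L[ℝ] ℝ)

/-! ### Smoothness on `TM ∖ {0}` -/

/-- `f ∈ C^∞(TM ∖ {0})`. -/
def SmoothFun (f : TM n M → ℝ) : Prop :=
  ContMDiffOn (𝓡 n).tangent 𝓘(ℝ, ℝ) ∞ f (slit n M)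

/-- `X` is a smooth vector field on `TM ∖ {0}`. -/
def SmoothVField (X : VField n M) : Prop :=
  ContMDiffOn (𝓡 n).tangent (𝓡 n).tangent.tangent ∞
    (fun u => (⟨u, X u⟩ : TangentBundle (𝓡 n).tangent (TM n M))) (slit n M)

/-- `θ ∈ Λ¹(TM ∖ {0})`: a smooth section of the cotangent bundle. -/
def SmoothOneForm (θ : OneForm n M) : Prop :=
  ContMDiffOn (𝓡 n).tangent ((𝓡 n).tangent.prod 𝓘(ℝ, ModelTM n →L[ℝ] ℝ)) ∞
    (fun u => TotalSpace.mk' (ModelTM n →L[ℝ] ℝ) (E := fun u : TM n M => TTM u →L[ℝ] ℝ) u (θ u))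
    (slit n M)

/-! ### Exterior derivative and Lie derivative -/

/-- The exterior derivative `df` of a function. -/
def dFun (f : TM n M → ℝ) : OneForm n M :=
  fun u => mfderiv (𝓡 n).tangent 𝓘(ℝ, ℝ) f u

/-- The `1`-form `θ` read in the chart `φ` of `TM` around `u`, i.e. the pullback of `θ`
under `φ⁻¹`, as a `1`-form on the model space. -/
def chartRep (θ : OneForm n M) (u : TM n M) (z : ModelTM n) : ModelTM n →L[ℝ] ℝ :=
  (θ ((extChartAt (𝓡 n).tangent u).symm z)).comp
    (mfderiv 𝓘(ℝ, ModelTM n) (𝓡 n).tangent (extChartAt (𝓡 n).tangent u).symm z)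

/-- The exterior derivative `dθ` of a `1`-form: at `u` it is `φ^* d((φ⁻¹)^* θ)`, where `φ` is the
chart of `TM` around `u`. -/
def dOne (θ : OneForm n M) : TwoForm n M := fun u =>
  (extDeriv (fun z => ContinuousAlternatingMap.ofSubsingleton ℝ (ModelTM n) ℝ (0 : Fin 1)
      (chartRep θ u z)) (extChartAt (𝓡 n).tangent u u)).compContinuousLinearMap
    (mfderiv (𝓡 n).tangent 𝓘(ℝ, ModelTM n) (extChartAt (𝓡 n).tangent u) u)

/-- The inner product `i_X θ` of a vector field and a `1`-form. -/
def iField (X : VField n M) (θ : OneForm n M) : TM n M → ℝ :=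
  fun u => θ u (X u)

/-- The Lie derivative `L_X θ = i_X dθ + d i_X θ` of a `1`-form, evaluated at `v ∈ T_u TM`. -/
def lieDerivOne (X : VField n M) (θ : OneForm n M) (u : TM n M) (v : TTM u) : ℝ :=
  dOne θ u ![X u, v] + dFun (iField X θ) u v

/-! ### Vertical calculus -/

/-- The differential `Dπ` at `u` of the projection `π : TM → M`. -/
def Dπ (u : TM n M) : TTM u →L[ℝ] TangentSpace (𝓡 n) u.proj :=
  mfderiv (𝓡 n).tangent (𝓡 n) (TotalSpace.proj : TM n M → M) u

/-- The vertical lift `T_{π(u)} M → T_u TM`, `z ↦ (u + t z)'(0)`: the differential at `u` of the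
inclusion of the fibre `T_{π(u)} M` into `TM`. -/
def vlift (u : TM n M) : TangentSpace (𝓡 n) u.proj →L[ℝ] TTM u :=
  mfderiv 𝓘(ℝ, EuclideanSpace ℝ (Fin n)) (𝓡 n).tangent
    (fun y : EuclideanSpace ℝ (Fin n) => (⟨u.proj, y⟩ : TM n M)) u.snd

/-- The Liouville vector field `ℂ(u) = (u + s u)'(0)`. -/
def liouville : VField n M := fun u => vlift u u.snd

/-- The tangent structure `J(ξ) = (u + t Dπ(ξ))'(0)` for `ξ ∈ T_u TM`. -/
def J (u : TM n M) : TTM u →L[ℝ] TTM u := (vlift u).comp (Dπ u)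

/-- `i_J θ` for a `1`-form `θ`. -/
def iJOne (θ : OneForm n M) : OneForm n M := fun u => (θ u).comp (J u)

/-- `i_J ω` for a `2`-form `α`, evaluated at `v, w ∈ T_u TM`. -/
def iJTwo (α : TwoForm n M) (u : TM n M) (v w : TTM u) : ℝ :=
  α u ![J u v, w] + α u ![v, J u w]

/-- `d_J f = i_J df - d i_J f` for a function `f`, where `i_J f = 0`. -/
def dJFun (f : TM n M → ℝ) : OneForm n M := iJOne (dFun f)

/-- `d_J θ = i_J dθ - d i_J θ` for a `1`-form `θ`, evaluated at `v, w ∈ T_u TM`. -/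
def dJOne (θ : OneForm n M) (u : TM n M) (v w : TTM u) : ℝ :=
  iJTwo (dOne θ) u v w - dOne (iJOne θ) u ![v, w]

/-- `θ` is semi-basic: it vanishes on the vertical vectors. -/
def IsSemiBasic (θ : OneForm n M) : Prop :=
  ∀ u ∈ slit n M, ∀ ξ : TTM u, Dπ u ξ = 0 → θ u ξ = 0

/-- `d_J θ = 0` on `TM ∖ {0}`. -/
def IsDJClosed (θ : OneForm n M) : Prop :=
  ∀ u ∈ slit n M, ∀ v w : TTM u, dJOne θ u v w = 0

/-- `θ = d_J f` on `TM ∖ {0}` for some `f ∈ C^∞(TM ∖ {0})`. -/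
def IsDJExact (θ : OneForm n M) : Prop :=
  ∃ f : TM n M → ℝ, SmoothFun f ∧ ∀ u ∈ slit n M, θ u = dJFun f u

/-! ### Homogeneity and sprays -/

/-- `f` is positively `k`-homogeneous: `f (λ y) = λ ^ k f y` for `λ > 0`. -/
def IsHomogFun (k : ℤ) (f : TM n M → ℝ) : Prop :=
  ∀ u ∈ slit n M, ∀ c : ℝ, 0 < c → f ⟨u.proj, c • u.snd⟩ = c ^ k * f u

/-- The `1`-form `θ` is `k`-homogeneous: `L_ℂ θ = k θ`. -/
def IsHomogOneForm (k : ℤ) (θ : OneForm n M) : Prop :=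
  ∀ u ∈ slit n M, ∀ v : TTM u, lieDerivOne liouville θ u v = (k : ℝ) * θ u v

/-- The vector field `X` is `k`-homogeneous: `L_ℂ X = [ℂ, X] = (k - 1) X`. -/
def IsHomogVField (k : ℤ) (X : VField n M) : Prop :=
  ∀ u ∈ slit n M,
    VectorField.mlieBracket (𝓡 n).tangent liouville X u = ((k : ℝ) - 1) • X u

/-- A semispray: a smooth vector field on `TM ∖ {0}` with `J S = ℂ`. -/
def IsSemispray (S : VField n M) : Prop :=
  SmoothVField S ∧ ∀ u ∈ slit n M, J u (S u) = liouville u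

/-- A spray: a semispray that is `2`-homogeneous as a vector field. -/
def IsSpray (S : VField n M) : Prop :=
  IsSemispray S ∧ IsHomogVField 2 S

end SlitTangent

end

noncomputable section

namespace SlitTangent

open Filter Topology

variable {n : ℕ} {M : Type*} [TopologicalSpace M]
  [ChartedSpace (EuclideanSpace ℝ (Fin n)) M] [IsManifold (𝓡 n) ∞ M]

/-! ### The charts of the tangent bundle -/

/-! In induced coordinates `(x, y)` on `TM`, the operator `J` is `(a, b) ↦ (0, a)`, `ℂ` is `(0, y)`,
and a semi-basic form is `θ = θ_i(x, y) dx^i`. Hence `d_J θ = 0` says that `∂θ_i/∂y^j` is symmetric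
(`IsSemiBasic.dJOne_apply`), and `L_ℂ θ = (k - 1) θ` says that `y^j ∂θ_i/∂y^j = (k - 1) θ_i`
(`IsSemiBasic.lieDerivOne_liouville`).

For (i), `d_J L = (∂L/∂y^i) dx^i`: closedness is the symmetry of the Hessian, and homogeneity is
Euler's identity differentiated in `y`.

For (ii), `J S = ℂ` makes the horizontal coordinate of `S` equal to `y`, so `k L = θ_i y^i`. Then `k
∂L/∂y^j = θ_j + y^i ∂θ_i/∂y^j = θ_j + y^i ∂θ_j/∂y^i = k θ_j`, using closedness and then homogeneity
(`IsPotential.eq_dJFun`). Any `f` with `θ = d_J f` satisfies `df(ℂ) = df(JS) = θ(S) = k L`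
(`IsPotential.dFun_liouville`). With `f = L` and the converse of Euler's theorem this gives
homogeneity of `L`; with `f = L'` homogeneous, Euler's theorem gives `k L' = k L`. -/

lemma mem_extChartAt_source_iff (u q : TM n M) :
    q ∈ (extChartAt (𝓡 n).tangent u).source ↔
      q.proj ∈ (chartAt (EuclideanSpace ℝ (Fin n)) u.proj).source := by
  rw [extChartAt_source]
  exact TangentBundle.mem_chart_source_iff q u

lemma extChartAt_fst (u q : TM n M) :
    (extChartAt (𝓡 n).tangent u q).1 = extChartAt (𝓡 n) u.proj q.proj := by
  rfl

lemma continuousLinearMapAt_tangent_apply (p q : M)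
    (hq : q ∈ (chartAt (EuclideanSpace ℝ (Fin n)) p).source) (y : TangentSpace (𝓡 n) q) :
    (trivializationAt (EuclideanSpace ℝ (Fin n)) (TangentSpace (𝓡 n)) p).continuousLinearMapAt ℝ q
      y = (trivializationAt (EuclideanSpace ℝ (Fin n)) (TangentSpace (𝓡 n)) p ⟨q, y⟩).2 := by
  rw [Trivialization.continuousLinearMapAt_apply, Trivialization.linearMapAt_apply, if_pos]
  simpa using hq

/-- The tangent bundle is trivialized by the differentials of charts of `M`. Linearity in the fibre
variable underlies all the coordinate formulas below. -/
lemma extChartAt_snd (u q : TM n M) (hq : q ∈ (extChartAt (𝓡 n).tangent u).source) :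
    (extChartAt (𝓡 n).tangent u q).2 =
      mfderiv (𝓡 n) 𝓘(ℝ, EuclideanSpace ℝ (Fin n)) (extChartAt (𝓡 n) u.proj) q.proj q.snd := by
  rw [mem_extChartAt_source_iff] at hq
  refine Eq.trans ?_ (DFunLike.congr_fun
    (TangentBundle.continuousLinearMapAt_trivializationAt (I := 𝓡 n) hq) q.snd)
  exact (continuousLinearMapAt_tangent_apply u.proj q.proj hq q.snd).symm

/-- The differential at `q` of the chart of `TM` around `u`. -/
def dchart (u q : TM n M) : TTM q →L[ℝ] ModelTM n :=
  mfderiv (𝓡 n).tangent 𝓘(ℝ, ModelTM n) (extChartAt (𝓡 n).tangent u) q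

/-- The differential at `z` of the inverse of the chart of `TM` around `u`. -/
def dsymm (u : TM n M) (z : ModelTM n) :
    ModelTM n →L[ℝ] TTM ((extChartAt (𝓡 n).tangent u).symm z) :=
  mfderiv 𝓘(ℝ, ModelTM n) (𝓡 n).tangent (extChartAt (𝓡 n).tangent u).symm z

lemma range_tangent : range (𝓡 n).tangent = univ := (𝓡 n).tangent.range_eq_univ

lemma dchart_dsymm (u : TM n M) {z : ModelTM n} (hz : z ∈ (extChartAt (𝓡 n).tangent u).target)
    (v : ModelTM n) :
    dchart u ((extChartAt (𝓡 n).tangent u).symm z) (dsymm u z v) = v := by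
  have h := mfderiv_extChartAt_comp_mfderivWithin_extChartAt_symm hz
  rw [range_tangent, mfderivWithin_univ] at h
  exact DFunLike.congr_fun h v

lemma dchart_injective (u q : TM n M) (hq : q ∈ (extChartAt (𝓡 n).tangent u).source) :
    Function.Injective (dchart u q) :=
  (isInvertible_mfderiv_extChartAt hq).injective

lemma dsymm_dchart (u : TM n M) {z : ModelTM n} (hz : z ∈ (extChartAt (𝓡 n).tangent u).target)
    (ξ : TTM ((extChartAt (𝓡 n).tangent u).symm z)) :
    dsymm u z (dchart u ((extChartAt (𝓡 n).tangent u).symm z) ξ) = ξ :=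
  dchart_injective u _ ((extChartAt (𝓡 n).tangent u).map_target hz) (dchart_dsymm u hz _)

lemma mfderiv_extChartAt_injective (p q : M)
    (hq : q ∈ (chartAt (EuclideanSpace ℝ (Fin n)) p).source) :
    Function.Injective
      (mfderiv (𝓡 n) 𝓘(ℝ, EuclideanSpace ℝ (Fin n)) (extChartAt (𝓡 n) p) q) := by
  have hq' : q ∈ (extChartAt (𝓡 n) p).source := by rwa [extChartAt_source]
  exact (isInvertible_mfderiv_extChartAt hq').injective

lemma mdifferentiableAt_tangent_extChartAt {u q : TM n M}
    (hq : q ∈ (extChartAt (𝓡 n).tangent u).source) :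
    MDifferentiableAt (𝓡 n).tangent 𝓘(ℝ, ModelTM n) (extChartAt (𝓡 n).tangent u) q := by
  rw [extChartAt_source] at hq
  exact mdifferentiableAt_extChartAt hq

/-- In a chart, `Dπ` is the first projection. -/
lemma dchart_fst (u q : TM n M) (hq : q ∈ (extChartAt (𝓡 n).tangent u).source) (ξ : TTM q) : (dchart u q ξ).1 =
      mfderiv (𝓡 n) 𝓘(ℝ, EuclideanSpace ℝ (Fin n)) (extChartAt (𝓡 n) u.proj) q.proj
        (Dπ q ξ) := by
  have hΦ := mdifferentiableAt_tangent_extChartAt hq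
  have hφ : MDifferentiableAt (𝓡 n) 𝓘(ℝ, EuclideanSpace ℝ (Fin n)) (extChartAt (𝓡 n) u.proj)
      q.proj := mdifferentiableAt_extChartAt ((mem_extChartAt_source_iff u q).1 hq)
  have hπ : MDifferentiableAt (𝓡 n).tangent (𝓡 n) (TotalSpace.proj : TM n M → M) q :=
    (contMDiff_proj (n := 1) (TangentSpace (𝓡 n) : M → Type _)).mdifferentiableAt one_ne_zero
  have hfst : MDifferentiableAt 𝓘(ℝ, ModelTM n) 𝓘(ℝ, EuclideanSpace ℝ (Fin n))
      (ContinuousLinearMap.fst ℝ (EuclideanSpace ℝ (Fin n)) (EuclideanSpace ℝ (Fin n)))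
      (extChartAt (𝓡 n).tangent u q) := by
    have h : DifferentiableAt ℝ (ContinuousLinearMap.fst ℝ (EuclideanSpace ℝ (Fin n))
      (EuclideanSpace ℝ (Fin n))) (extChartAt (𝓡 n).tangent u q) :=
      ContinuousLinearMap.differentiableAt _
    exact h.mdifferentiableAt
  have h1 := mfderiv_comp q hfst hΦ
  have h2 := mfderiv_comp q hφ hπ
  have h3 : (ContinuousLinearMap.fst ℝ (EuclideanSpace ℝ (Fin n)) (EuclideanSpace ℝ (Fin n))) ∘
      (extChartAt (𝓡 n).tangent u) = (extChartAt (𝓡 n) u.proj) ∘ TotalSpace.proj := rfl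
  rw [h3, h2, mfderiv_eq_fderiv, ContinuousLinearMap.fderiv] at h1
  exact (DFunLike.congr_fun h1 ξ).symm

lemma mdifferentiableAt_fibre (p : M) (y : EuclideanSpace ℝ (Fin n)) :
    MDifferentiableAt 𝓘(ℝ, EuclideanSpace ℝ (Fin n)) (𝓡 n).tangent
      (fun y : EuclideanSpace ℝ (Fin n) => (⟨p, y⟩ : TM n M)) y := by
  have : ContMDiffAt 𝓘(ℝ, EuclideanSpace ℝ (Fin n)) (𝓡 n).tangent 1
      (fun y : EuclideanSpace ℝ (Fin n) => (⟨p, y⟩ : TM n M)) y := by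
    rw [contMDiffAt_totalSpace]
    refine ⟨contMDiffAt_const, ?_⟩
    have h : (fun x : EuclideanSpace ℝ (Fin n) =>
        (trivializationAt (EuclideanSpace ℝ (Fin n)) (TangentSpace (𝓡 n)) p ⟨p, x⟩).2) =
        ((trivializationAt (EuclideanSpace ℝ (Fin n)) (TangentSpace (𝓡 n)) p).continuousLinearMapAt
          ℝ p : EuclideanSpace ℝ (Fin n) →L[ℝ] EuclideanSpace ℝ (Fin n)) :=
      funext fun x => (continuousLinearMapAt_tangent_apply p p (mem_chart_source _ p) x).symm
    refine ContDiffAt.contMDiffAt ?_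
    exact (congrArg (fun f => ContDiffAt ℝ 1 f y) h).mpr (ContinuousLinearMap.contDiff _).contDiffAt
  exact this.mdifferentiableAt one_ne_zero

/-- In a chart, the vertical lift is a linear map into the second factor. -/
lemma dchart_vlift (u q : TM n M) (hq : q ∈ (extChartAt (𝓡 n).tangent u).source)
    (b : TangentSpace (𝓡 n) q.proj) :
    dchart u q (vlift q b) =
      (0, mfderiv (𝓡 n) 𝓘(ℝ, EuclideanSpace ℝ (Fin n)) (extChartAt (𝓡 n) u.proj) q.proj b) := by
  have hΦ := mdifferentiableAt_tangent_extChartAt hq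
  have h1 := mfderiv_comp q.snd (I := 𝓘(ℝ, EuclideanSpace ℝ (Fin n)))
    (f := fun y : EuclideanSpace ℝ (Fin n) => (⟨q.proj, y⟩ : TM n M)) hΦ
    (mdifferentiableAt_fibre q.proj q.snd)
  -- On a fixed fibre the chart is `y ↦ (const, A y)`, whose derivative is `(0, A)`.
  set A : EuclideanSpace ℝ (Fin n) →L[ℝ] EuclideanSpace ℝ (Fin n) :=
    mfderiv (𝓡 n) 𝓘(ℝ, EuclideanSpace ℝ (Fin n)) (extChartAt (𝓡 n) u.proj) q.proj with hA
  have h3 : (extChartAt (𝓡 n).tangent u) ∘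
      (fun y : EuclideanSpace ℝ (Fin n) => (⟨q.proj, y⟩ : TM n M)) =
      fun y => (extChartAt (𝓡 n) u.proj q.proj, A y) := by
    funext y
    have hy : (⟨q.proj, y⟩ : TM n M) ∈ (extChartAt (𝓡 n).tangent u).source := by
      rw [mem_extChartAt_source_iff] at hq ⊢
      exact hq
    exact Prod.ext (extChartAt_fst u _) (extChartAt_snd u _ hy)
  have h4 : HasFDerivAt (fun y => (extChartAt (𝓡 n) u.proj q.proj, A y))
      ((0 : EuclideanSpace ℝ (Fin n) →L[ℝ] EuclideanSpace ℝ (Fin n)).prod A) q.snd :=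
    (hasFDerivAt_const _ _).prodMk A.hasFDerivAt
  rw [h3] at h1
  exact (DFunLike.congr_fun (h1.symm.trans h4.hasMFDerivAt.mfderiv) b)

/-- In a chart, the tangent structure is `(a, b) ↦ (0, a)`. -/
lemma dchart_J (u q : TM n M) (hq : q ∈ (extChartAt (𝓡 n).tangent u).source) (ξ : TTM q) :
    dchart u q (J q ξ) =
      (0, (dchart u q ξ).1) := by
  rw [dchart_fst u q hq]
  exact dchart_vlift u q hq _

/-- In a chart, the Liouville vector field is `(x, y) ↦ (0, y)`. -/
lemma dchart_liouville (u q : TM n M) (hq : q ∈ (extChartAt (𝓡 n).tangent u).source) :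
    dchart u q (liouville q) = (0, (extChartAt (𝓡 n).tangent u q).2) := by
  rw [extChartAt_snd u q hq]
  exact dchart_vlift u q hq _

lemma Dπ_eq_zero_iff (u q : TM n M) (hq : q ∈ (extChartAt (𝓡 n).tangent u).source) (ξ : TTM q) :
    Dπ q ξ = 0 ↔ (dchart u q ξ).1 = 0 := by
  rw [dchart_fst u q hq]
  constructor
  · intro h
    rw [h]
    exact map_zero _
  · intro h
    refine mfderiv_extChartAt_injective u.proj q.proj ((mem_extChartAt_source_iff u q).1 hq) ?_
    rw [h]
    exact (map_zero _).symm

lemma mem_slit_iff (u q : TM n M) (hq : q ∈ (extChartAt (𝓡 n).tangent u).source) :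
    q ∈ slit n M ↔ (extChartAt (𝓡 n).tangent u q).2 ≠ 0 := by
  rw [extChartAt_snd u q hq, slit, mem_ofPred_eq, not_iff_not]
  constructor
  · intro h
    rw [h]
    exact map_zero _
  · intro h
    refine mfderiv_extChartAt_injective u.proj q.proj ((mem_extChartAt_source_iff u q).1 hq) ?_
    rw [h]
    exact (map_zero _).symm

variable (n M) in
lemma isOpen_slit : IsOpen (slit n M) := by
  rw [isOpen_iff_mem_nhds]
  intro u hu
  have hs := mem_extChartAt_source (I := (𝓡 n).tangent) u
  have h1 := extChartAt_source_mem_nhds (I := (𝓡 n).tangent) u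
  have h2 : ∀ᶠ q in 𝓝 u, (extChartAt (𝓡 n).tangent u q).2 ≠ 0 :=
    (continuous_snd.continuousAt.comp (continuousAt_extChartAt u)).eventually_ne
      ((mem_slit_iff u u hs).1 hu)
  filter_upwards [h1, h2] with q hq hq2
  exact (mem_slit_iff u q hq).2 hq2

/-- The points of the model space that correspond to points of `TM ∖ {0}` in the chart
around `u`. -/
def slitTarget (u : TM n M) : Set (ModelTM n) :=
  {z | z ∈ (extChartAt (𝓡 n).tangent u).target ∧ z.2 ≠ 0}

lemma symm_mem_slit {u : TM n M} {z : ModelTM n} (hz : z ∈ slitTarget u) :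
    (extChartAt (𝓡 n).tangent u).symm z ∈ slit n M := by
  rw [mem_slit_iff u _ ((extChartAt (𝓡 n).tangent u).map_target hz.1),
    (extChartAt (𝓡 n).tangent u).right_inv hz.1]
  exact hz.2

lemma isOpen_slitTarget (u : TM n M) : IsOpen (slitTarget u) :=
  (isOpen_extChartAt_target (I := (𝓡 n).tangent) u).inter
    (isOpen_ne.preimage continuous_snd)

lemma extChartAt_mem_slitTarget {u q : TM n M} (hq : q ∈ (extChartAt (𝓡 n).tangent u).source)
    (hs : q ∈ slit n M) : extChartAt (𝓡 n).tangent u q ∈ slitTarget u :=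
  ⟨(extChartAt (𝓡 n).tangent u).map_source hq, (mem_slit_iff u q hq).1 hs⟩

lemma extChartAt_self_mem_slitTarget {u : TM n M} (hs : u ∈ slit n M) :
    extChartAt (𝓡 n).tangent u u ∈ slitTarget u :=
  extChartAt_mem_slitTarget (mem_extChartAt_source _) hs

/-! ### Functions and forms in a chart -/

/-- The chart is centred at `u` but evaluated at nearby `q`: differentiating a form at `u` requires
one fixed chart on a neighbourhood. -/
lemma apply_eq_chartRep (θ : OneForm n M) {u q : TM n M}
    (hq : q ∈ (extChartAt (𝓡 n).tangent u).source) (ξ : TTM q) :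
    θ q ξ = chartRep θ u (extChartAt (𝓡 n).tangent u q) (dchart u q ξ) := by
  obtain ⟨z, hz, rfl⟩ : ∃ z ∈ (extChartAt (𝓡 n).tangent u).target,
      (extChartAt (𝓡 n).tangent u).symm z = q :=
    ⟨_, (extChartAt (𝓡 n).tangent u).map_source hq, (extChartAt (𝓡 n).tangent u).left_inv hq⟩
  rw [(extChartAt (𝓡 n).tangent u).right_inv hz]
  exact congrArg (θ _) (dsymm_dchart u hz ξ).symm

lemma chartRep_iJOne (θ : OneForm n M) (u : TM n M) {z : ModelTM n}
    (hz : z ∈ (extChartAt (𝓡 n).tangent u).target) (v : ModelTM n) :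
    chartRep (iJOne θ) u z v = chartRep θ u z (0, v.1) := by
  have hq := (extChartAt (𝓡 n).tangent u).map_target hz
  refine Eq.trans (b := θ ((extChartAt (𝓡 n).tangent u).symm z) (J _ _)) rfl ?_
  rw [apply_eq_chartRep θ hq]
  rw [dchart_J u _ hq, (extChartAt (𝓡 n).tangent u).right_inv hz]
  refine congrArg (fun w : ModelTM n => chartRep θ u z (0, w.1)) ?_
  exact dchart_dsymm u hz v

lemma chartRep_vertical {θ : OneForm n M} (h : IsSemiBasic θ) (u : TM n M) {z : ModelTM n}
    (hz : z ∈ slitTarget u) (b : EuclideanSpace ℝ (Fin n)) :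
    chartRep θ u z (0, b) = 0 := by
  have hq := (extChartAt (𝓡 n).tangent u).map_target hz.1
  refine h _ (symm_mem_slit hz) _ ?_
  rw [Dπ_eq_zero_iff u _ hq]
  exact congrArg Prod.fst (dchart_dsymm u hz.1 (0, b))

lemma contMDiffAt_iff_contDiffAt {F : Type*} [NormedAddCommGroup F] [NormedSpace ℝ F]
    (g : ModelTM n → F) (u : TM n M) :
    ContMDiffAt (𝓡 n).tangent 𝓘(ℝ, F) ∞ (fun q => g (extChartAt (𝓡 n).tangent u q)) u ↔
      ContDiffAt ℝ ∞ g (extChartAt (𝓡 n).tangent u u) := by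
  constructor
  · intro h
    have hs : ContMDiffAt 𝓘(ℝ, ModelTM n) (𝓡 n).tangent ∞ (extChartAt (𝓡 n).tangent u).symm
        (extChartAt (𝓡 n).tangent u u) :=
      (contMDiffOn_extChartAt_symm u).contMDiffAt (extChartAt_target_mem_nhds u)
    have h' : ContMDiffAt (𝓡 n).tangent 𝓘(ℝ, F) ∞
        (fun q => g (extChartAt (𝓡 n).tangent u q))
        ((extChartAt (𝓡 n).tangent u).symm (extChartAt (𝓡 n).tangent u u)) := by
      rwa [extChartAt_to_inv]
    refine ((h'.comp _ hs).congr_of_eventuallyEq ?_).contDiffAt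
    filter_upwards [extChartAt_target_mem_nhds (I := (𝓡 n).tangent) u] with z hz
    exact (congrArg g ((extChartAt (𝓡 n).tangent u).right_inv hz)).symm
  · intro h
    exact h.contMDiffAt.comp u contMDiffAt_extChartAt

lemma SmoothFun.contDiffAt {f : TM n M → ℝ} (hf : SmoothFun f) {u : TM n M}
    (hu : u ∈ slit n M) :
    ContDiffAt ℝ ∞ (f ∘ (extChartAt (𝓡 n).tangent u).symm) (extChartAt (𝓡 n).tangent u u) := by
  rw [← contMDiffAt_iff_contDiffAt]
  refine (hf.contMDiffAt ((isOpen_slit n M).mem_nhds hu)).congr_of_eventuallyEq ?_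
  filter_upwards [extChartAt_source_mem_nhds (I := (𝓡 n).tangent) u] with q hq
  exact congrArg f ((extChartAt (𝓡 n).tangent u).left_inv hq)

lemma smoothFun_of_contDiffAt {f : TM n M → ℝ}
    (h : ∀ u ∈ slit n M, ContDiffAt ℝ ∞ (f ∘ (extChartAt (𝓡 n).tangent u).symm)
      (extChartAt (𝓡 n).tangent u u)) : SmoothFun f := by
  intro u hu
  refine (((contMDiffAt_iff_contDiffAt _ u).2 (h u hu)).congr_of_eventuallyEq
    ?_).contMDiffWithinAt
  filter_upwards [extChartAt_source_mem_nhds (I := (𝓡 n).tangent) u] with q hq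
  exact (congrArg f ((extChartAt (𝓡 n).tangent u).left_inv hq)).symm

/-- The trivialization of `T(TM)` at `u` is the differential of the chart at `u`, so the section
read in it is the coordinate form near `u`. -/
lemma contMDiffAt_section_iff (θ : OneForm n M) (u : TM n M) :
    ContMDiffAt (𝓡 n).tangent ((𝓡 n).tangent.prod 𝓘(ℝ, ModelTM n →L[ℝ] ℝ)) ∞
      (fun u => TotalSpace.mk' (ModelTM n →L[ℝ] ℝ) (E := fun u : TM n M => TTM u →L[ℝ] ℝ) u (θ u))
      u ↔ ContDiffAt ℝ ∞ (chartRep θ u) (extChartAt (𝓡 n).tangent u u) := by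
  rw [contMDiffAt_hom_bundle, ← contMDiffAt_iff_contDiffAt]
  refine (and_iff_right contMDiffAt_id).trans ?_
  refine Filter.EventuallyEq.contMDiffAt_iff ?_
  filter_upwards [extChartAt_source_mem_nhds (I := (𝓡 n).tangent) u] with q hq
  refine ContinuousLinearMap.ext fun v => ?_
  have hq' : q ∈ (chartAt (ModelProd (EuclideanSpace ℝ (Fin n)) (EuclideanSpace ℝ (Fin n)))
      u).source := by rwa [extChartAt_source] at hq
  have hb : q ∈ (trivializationAt (ModelTM n) (TangentSpace (𝓡 n).tangent : TM n M → Type _)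
      u).baseSet := by simpa using hq'
  have h := apply_eq_chartRep θ hq ((trivializationAt (ModelTM n)
    (TangentSpace (𝓡 n).tangent : TM n M → Type _) u).symmL ℝ q v)
  have h2 := DFunLike.congr_fun
    (TangentBundle.continuousLinearMapAt_trivializationAt (I := (𝓡 n).tangent) hq')
    ((trivializationAt (ModelTM n) (TangentSpace (𝓡 n).tangent : TM n M → Type _) u).symmL ℝ q v)
  rw [Trivialization.continuousLinearMapAt_symmL _ hb] at h2
  refine Eq.trans ?_ (h.trans (congrArg _ h2.symm))
  exact congrFun (Trivialization.coe_linearMapAt_of_mem (R := ℝ)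
    (trivializationAt ℝ (fun _ : TM n M => ℝ) u) (mem_univ q)) _

lemma SmoothOneForm.contDiffAt {θ : OneForm n M} (hθ : SmoothOneForm θ) {u : TM n M}
    (hu : u ∈ slit n M) :
    ContDiffAt ℝ ∞ (chartRep θ u) (extChartAt (𝓡 n).tangent u u) :=
  (contMDiffAt_section_iff θ u).1 (hθ.contMDiffAt ((isOpen_slit n M).mem_nhds hu))

lemma smoothOneForm_of_contDiffAt {θ : OneForm n M}
    (h : ∀ u ∈ slit n M, ContDiffAt ℝ ∞ (chartRep θ u) (extChartAt (𝓡 n).tangent u u)) :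
    SmoothOneForm θ :=
  fun u hu => ((contMDiffAt_section_iff θ u).2 (h u hu)).contMDiffWithinAt

lemma dFun_apply {f : TM n M → ℝ} {u q : TM n M}
    (hq : q ∈ (extChartAt (𝓡 n).tangent u).source)
    (hf : DifferentiableAt ℝ (f ∘ (extChartAt (𝓡 n).tangent u).symm)
      (extChartAt (𝓡 n).tangent u q)) (ξ : TTM q) :
    dFun f q ξ = fderiv ℝ (f ∘ (extChartAt (𝓡 n).tangent u).symm) (extChartAt (𝓡 n).tangent u q) (dchart u q ξ) := by
  have h := hf.hasFDerivAt.hasMFDerivAt.comp q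
    (mdifferentiableAt_tangent_extChartAt hq).hasMFDerivAt
  have h2 : f =ᶠ[𝓝 q] (f ∘ (extChartAt (𝓡 n).tangent u).symm) ∘ extChartAt (𝓡 n).tangent u := by
    filter_upwards [extChartAt_source_mem_nhds' (I := (𝓡 n).tangent) hq] with p hp
    exact (congrArg f ((extChartAt (𝓡 n).tangent u).left_inv hp)).symm
  exact DFunLike.congr_fun (h.congr_of_eventuallyEq h2).mfderiv ξ

lemma chartRep_dFun {f : TM n M → ℝ} {u : TM n M} {z : ModelTM n}
    (hz : z ∈ (extChartAt (𝓡 n).tangent u).target)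
    (hf : DifferentiableAt ℝ (f ∘ (extChartAt (𝓡 n).tangent u).symm) z) :
    chartRep (dFun f) u z = fderiv ℝ (f ∘ (extChartAt (𝓡 n).tangent u).symm) z := by
  have hq := (extChartAt (𝓡 n).tangent u).map_target hz
  have hr := (extChartAt (𝓡 n).tangent u).right_inv hz
  refine ContinuousLinearMap.ext fun v => ?_
  refine (dFun_apply hq (by rwa [hr]) _).trans ?_
  rw [hr]
  exact congrArg _ (dchart_dsymm u hz v)

lemma extDeriv_ofSubsingleton_apply {E : Type*} [NormedAddCommGroup E] [NormedSpace ℝ E]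
    {η : E → E →L[ℝ] ℝ} {x : E} (h : DifferentiableAt ℝ η x) (v w : E) :
    extDeriv (fun z => ContinuousAlternatingMap.ofSubsingleton ℝ E ℝ (0 : Fin 1) (η z)) x ![v, w] =
      fderiv ℝ η x v w - fderiv ℝ η x w v := by
  have hη : DifferentiableAt ℝ (fun z => ContinuousAlternatingMap.ofSubsingleton ℝ E ℝ
      (0 : Fin 1) (η z)) x :=
    (ContinuousAlternatingMap.ofSubsingletonLIE (𝕜 := ℝ) (E := E) (F := ℝ) (0 : Fin 1)).differentiableAt.comp x h
  have hd : ∀ a : E, fderiv ℝ (fun z => η z a) x = (fderiv ℝ η x).flip a := fun a => by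
    ext b
    rw [fderiv_clm_apply h (differentiableAt_const a)]
    simp
  rw [extDeriv_apply hη, Fin.sum_univ_two]
  simp [Fin.removeNth, Fin.succAbove, hd, sub_eq_add_neg]

lemma dOne_apply {θ : OneForm n M} {u : TM n M}
    (h : DifferentiableAt ℝ (chartRep θ u) (extChartAt (𝓡 n).tangent u u)) (v w : TTM u) :
    dOne θ u ![v, w] =
      fderiv ℝ (chartRep θ u) (extChartAt (𝓡 n).tangent u u) (dchart u u v) (dchart u u w) -
      fderiv ℝ (chartRep θ u) (extChartAt (𝓡 n).tangent u u) (dchart u u w) (dchart u u v) := by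
  refine Eq.trans ?_ (extDeriv_ofSubsingleton_apply h _ _)
  refine Eq.trans (ContinuousAlternatingMap.compContinuousLinearMap_apply _ _ _) ?_
  refine congrArg _ (funext fun i => ?_)
  fin_cases i <;> rfl

/-! ### Semi-basic forms -/

lemma fderiv_apply_of_eventuallyEq_zero {E : Type*} [NormedAddCommGroup E] [NormedSpace ℝ E]
    {η : E → E →L[ℝ] ℝ} {x b : E} (h : DifferentiableAt ℝ η x) (hb : ∀ᶠ z in 𝓝 x, η z b = 0)
    (v : E) : fderiv ℝ η x v b = 0 := by
  have h1 : fderiv ℝ (fun z => η z b) x v = fderiv ℝ η x v b := by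
    rw [fderiv_clm_apply h (differentiableAt_const b)]
    simp
  have h2 : (fun z => η z b) =ᶠ[𝓝 x] fun _ => (0 : ℝ) := hb
  rw [← h1, h2.fderiv_eq]
  simp

/-- The components along `dy` vanish on a whole neighbourhood, hence so do their derivatives. -/
lemma IsSemiBasic.fderiv_vertical {θ : OneForm n M} (hs : IsSemiBasic θ) {u : TM n M}
    (hu : u ∈ slit n M)
    (h : DifferentiableAt ℝ (chartRep θ u) (extChartAt (𝓡 n).tangent u u))
    (v : ModelTM n) (b : EuclideanSpace ℝ (Fin n)) :
    fderiv ℝ (chartRep θ u) (extChartAt (𝓡 n).tangent u u) v (0, b) = 0 := by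
  refine fderiv_apply_of_eventuallyEq_zero h ?_ v
  filter_upwards [(isOpen_slitTarget u).mem_nhds (extChartAt_self_mem_slitTarget hu)] with z hz
  exact chartRep_vertical hs u hz b

lemma IsSemiBasic.dOne_iJOne {θ : OneForm n M} (hs : IsSemiBasic θ) {u : TM n M}
    (hu : u ∈ slit n M) (v w : TTM u) : dOne (iJOne θ) u ![v, w] = 0 := by
  have h : chartRep (iJOne θ) u =ᶠ[𝓝 (extChartAt (𝓡 n).tangent u u)] fun _ => 0 := by
    filter_upwards [(isOpen_slitTarget u).mem_nhds (extChartAt_self_mem_slitTarget hu)] with z hz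
    refine ContinuousLinearMap.ext fun a => ?_
    rw [chartRep_iJOne θ u hz.1, chartRep_vertical hs u hz]
    rfl
  rw [dOne_apply (h.differentiableAt_iff.2 (differentiableAt_const _)), h.fderiv_eq,
    fderiv_fun_const]
  exact sub_self (0 : ℝ)

/-- The coordinate expression of `d_J θ` for a semi-basic form `θ`. -/
lemma IsSemiBasic.dJOne_apply {θ : OneForm n M} (hs : IsSemiBasic θ) {u : TM n M}
    (hu : u ∈ slit n M)
    (h : DifferentiableAt ℝ (chartRep θ u) (extChartAt (𝓡 n).tangent u u)) (v w : TTM u) :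
    dJOne θ u v w =
      fderiv ℝ (chartRep θ u) (extChartAt (𝓡 n).tangent u u)
        (0, (dchart u u v).1) (dchart u u w) -
      fderiv ℝ (chartRep θ u) (extChartAt (𝓡 n).tangent u u)
        (0, (dchart u u w).1) (dchart u u v) := by
  have hsrc := mem_extChartAt_source (I := (𝓡 n).tangent) u
  unfold dJOne iJTwo
  -- Of the four terms of `i_J dθ`, the two that evaluate the derivative of `θ` on a vertical vector
  -- drop out.
  rw [hs.dOne_iJOne hu, dOne_apply h, dOne_apply h, dchart_J u u hsrc, dchart_J u u hsrc,
    hs.fderiv_vertical hu h, hs.fderiv_vertical hu h]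
  ring

/-- The coordinate expression of `L_ℂ θ` for a semi-basic form `θ`. -/
lemma IsSemiBasic.lieDerivOne_liouville {θ : OneForm n M} (hs : IsSemiBasic θ) {u : TM n M}
    (hu : u ∈ slit n M)
    (h : DifferentiableAt ℝ (chartRep θ u) (extChartAt (𝓡 n).tangent u u)) (v : TTM u) :
    lieDerivOne liouville θ u v =
      fderiv ℝ (chartRep θ u) (extChartAt (𝓡 n).tangent u u)
        (0, (extChartAt (𝓡 n).tangent u u).2) (dchart u u v) := by
  have hsrc := mem_extChartAt_source (I := (𝓡 n).tangent) u
  -- `ℂ` is vertical, so only `i_ℂ dθ` survives in Cartan's formula.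
  have h0 : iField liouville θ =ᶠ[𝓝 u] fun _ => 0 := by
    filter_upwards [(isOpen_slit n M).mem_nhds hu] with q hq
    refine hs q hq _ ?_
    rw [Dπ_eq_zero_iff q q (mem_extChartAt_source q), dchart_liouville q q (mem_extChartAt_source q)]
  have h1 : dFun (iField liouville θ) u v = 0 := by
    unfold dFun
    rw [h0.mfderiv_eq, mfderiv_const]
    rfl
  unfold lieDerivOne
  rw [h1, dOne_apply h, dchart_liouville u u hsrc, hs.fderiv_vertical hu h]
  ring

/-! ### Euler's theorem -/

lemma SmoothFun.mdifferentiableAt {f : TM n M → ℝ} (hf : SmoothFun f) {u : TM n M}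
    (hu : u ∈ slit n M) : MDifferentiableAt (𝓡 n).tangent 𝓘(ℝ, ℝ) f u :=
  (hf.contMDiffAt ((isOpen_slit n M).mem_nhds hu)).mdifferentiableAt (by simp)

/-- Chain rule along the ray `t ↦ t y`; it reduces both directions of Euler's theorem to
one-variable calculus. -/
lemma SmoothFun.hasDerivAt_ray {f : TM n M → ℝ} (hf : SmoothFun f) {u : TM n M} {t : ℝ}
    (hu : (⟨u.proj, t • u.snd⟩ : TM n M) ∈ slit n M) :
    HasDerivAt (fun s : ℝ => f ⟨u.proj, s • u.snd⟩)
      (dFun f ⟨u.proj, t • u.snd⟩ (vlift ⟨u.proj, t • u.snd⟩ u.snd)) t := by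
  let y : EuclideanSpace ℝ (Fin n) := u.snd
  have h1 : HasMFDerivAt 𝓘(ℝ, EuclideanSpace ℝ (Fin n)) 𝓘(ℝ, ℝ)
      (f ∘ fun y : EuclideanSpace ℝ (Fin n) => (⟨u.proj, y⟩ : TM n M)) (t • y)
      ((dFun f ⟨u.proj, t • u.snd⟩).comp (vlift ⟨u.proj, t • u.snd⟩)) :=
    (hf.mdifferentiableAt hu).hasMFDerivAt.comp (t • y)
      (mdifferentiableAt_fibre u.proj (t • y)).hasMFDerivAt
  have h2 : HasDerivAt (fun s : ℝ => s • y) y t := by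
    simpa using (hasDerivAt_id t).smul_const y
  exact h1.hasFDerivAt.comp_hasDerivAt t h2

lemma smul_mem_slit {u : TM n M} (hu : u ∈ slit n M) {t : ℝ} (ht : t ≠ 0) :
    (⟨u.proj, t • u.snd⟩ : TM n M) ∈ slit n M :=
  smul_ne_zero ht hu

lemma dFun_liouville_smul (f : TM n M → ℝ) (u : TM n M) (t : ℝ) :
    dFun f ⟨u.proj, t • u.snd⟩ (liouville ⟨u.proj, t • u.snd⟩) =
      t * dFun f ⟨u.proj, t • u.snd⟩ (vlift ⟨u.proj, t • u.snd⟩ u.snd) := by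
  unfold liouville
  rw [ContinuousLinearMap.map_smul, ContinuousLinearMap.map_smul]
  rfl

lemma IsHomogFun.dFun_liouville {f : TM n M → ℝ} {k : ℤ} (hk : IsHomogFun k f)
    (hf : SmoothFun f) {u : TM n M} (hu : u ∈ slit n M) :
    dFun f u (liouville u) = k * f u := by
  have h1 := hf.hasDerivAt_ray (smul_mem_slit hu (one_ne_zero (α := ℝ)))
  have h2 : HasDerivAt (fun s : ℝ => s ^ k * f u) ((k * 1 ^ (k - 1)) * f u) 1 :=
    (hasDerivAt_zpow k 1 (Or.inl one_ne_zero)).mul_const _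
  have h3 : (fun s : ℝ => f ⟨u.proj, s • u.snd⟩) =ᶠ[𝓝 1] fun s : ℝ => s ^ k * f u := by
    filter_upwards [lt_mem_nhds (zero_lt_one (α := ℝ))] with s hs
    exact hk u hu s hs
  have h4 := (h1.congr_of_eventuallyEq h3.symm).unique h2
  have h5 := dFun_liouville_smul f u 1
  rw [h4] at h5
  rw [one_smul] at h5
  simpa using h5

lemma isHomogFun_of_dFun_liouville {f : TM n M → ℝ} {k : ℤ} (hf : SmoothFun f)
    (h : ∀ u ∈ slit n M, dFun f u (liouville u) = k * f u) : IsHomogFun k f := by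
  intro u hu c hc
  -- Euler's identity makes `t ^ (-k) f(t y)` constant on `t > 0`; the values at `c` and `1` are
  -- then compared.
  have hd : ∀ t ∈ Ioi (0 : ℝ),
      HasDerivAt (fun s : ℝ => s ^ (-k) * f ⟨u.proj, s • u.snd⟩) 0 t := by
    intro t ht
    have ht0 : t ≠ 0 := (mem_Ioi.1 ht).ne'
    have h1 := hf.hasDerivAt_ray (smul_mem_slit hu ht0)
    have h2 := (hasDerivAt_zpow (-k) t (Or.inl ht0)).mul h1
    have h3 := dFun_liouville_smul f u t
    rw [h _ (smul_mem_slit hu ht0)] at h3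
    refine h2.congr_deriv ?_
    have h4 : t ^ (-k) = t ^ (-k - 1) * t := by
      rw [← zpow_add_one₀ ht0]; congr 1; ring
    rw [h4]
    push_cast
    linear_combination (-(t ^ (-k - 1))) * h3
  have hconst := isOpen_Ioi.is_const_of_deriv_eq_zero (convex_Ioi (0 : ℝ)).isPreconnected
    (fun t ht => (hd t ht).differentiableAt.differentiableWithinAt)
    (fun t ht => (hd t ht).deriv) (mem_Ioi.2 hc) (mem_Ioi.2 one_pos)
  simp only [one_zpow, one_smul, one_mul] at hconst
  have hc0 : c ^ k ≠ 0 := zpow_ne_zero _ hc.ne'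
  rw [zpow_neg, inv_mul_eq_iff_eq_mul₀ hc0] at hconst
  exact hconst

/-! ### The Poincaré–Cartan form -/

lemma isSemiBasic_dJFun (f : TM n M → ℝ) : IsSemiBasic (dJFun f) := by
  intro u _ ξ hξ
  have : J u ξ = 0 := (congrArg (vlift u) hξ).trans (map_zero _)
  exact (congrArg (dFun f u) this).trans (map_zero _)

/-- The linear map `(a, b) ↦ (0, a)`, the tangent structure in coordinates. -/
def modelJ (n : ℕ) : ModelTM n →L[ℝ] ModelTM n :=
  (ContinuousLinearMap.inr ℝ (EuclideanSpace ℝ (Fin n)) (EuclideanSpace ℝ (Fin n))).comp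
    (ContinuousLinearMap.fst ℝ _ _)

lemma SmoothFun.eventually_differentiableAt {f : TM n M → ℝ} (hf : SmoothFun f) {u : TM n M}
    (hu : u ∈ slit n M) : ∀ᶠ z in 𝓝 (extChartAt (𝓡 n).tangent u u),
      DifferentiableAt ℝ (f ∘ (extChartAt (𝓡 n).tangent u).symm) z := by
  filter_upwards [((hf.contDiffAt hu).of_le (m := 1) (by simp)).eventually (by simp)] with z hz
  exact hz.differentiableAt one_ne_zero

/-- Equality near the point, not only at it, lets the coordinate form be differentiated once more.
-/
lemma SmoothFun.chartRep_dJFun {f : TM n M → ℝ} (hf : SmoothFun f) {u : TM n M}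
    (hu : u ∈ slit n M) :
    chartRep (dJFun f) u =ᶠ[𝓝 (extChartAt (𝓡 n).tangent u u)]
      fun z => (fderiv ℝ (f ∘ (extChartAt (𝓡 n).tangent u).symm) z).comp (modelJ n) := by
  filter_upwards [hf.eventually_differentiableAt hu,
    extChartAt_target_mem_nhds (I := (𝓡 n).tangent) u] with z hz hzt
  refine ContinuousLinearMap.ext fun v => ?_
  rw [← chartRep_dFun hzt hz]
  exact chartRep_iJOne (dFun f) u hzt v

lemma SmoothFun.contDiffAt_fderiv {f : TM n M → ℝ} (hf : SmoothFun f) {u : TM n M}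
    (hu : u ∈ slit n M) :
    ContDiffAt ℝ ∞ (fderiv ℝ (f ∘ (extChartAt (𝓡 n).tangent u).symm))
      (extChartAt (𝓡 n).tangent u u) :=
  (hf.contDiffAt hu).fderiv_right (by simp)

lemma SmoothFun.smoothOneForm_dJFun {f : TM n M → ℝ} (hf : SmoothFun f) :
    SmoothOneForm (dJFun f) :=
  smoothOneForm_of_contDiffAt fun _ hu =>
    ((hf.contDiffAt_fderiv hu).clm_comp contDiffAt_const).congr_of_eventuallyEq
      (hf.chartRep_dJFun hu)

lemma SmoothFun.fderiv_chartRep_dJFun {f : TM n M → ℝ} (hf : SmoothFun f) {u : TM n M}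
    (hu : u ∈ slit n M) (v w : ModelTM n) :
    fderiv ℝ (chartRep (dJFun f) u) (extChartAt (𝓡 n).tangent u u) v w =
      fderiv ℝ (fderiv ℝ (f ∘ (extChartAt (𝓡 n).tangent u).symm))
        (extChartAt (𝓡 n).tangent u u) v (0, w.1) := by
  rw [(hf.chartRep_dJFun hu).fderiv_eq,
    fderiv_clm_comp ((hf.contDiffAt_fderiv hu).differentiableAt (by simp))
      (differentiableAt_const _)]
  simp [modelJ]

lemma SmoothFun.fderiv_fderiv_symm {f : TM n M → ℝ} (hf : SmoothFun f) {u : TM n M}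
    (hu : u ∈ slit n M) (v w : ModelTM n) :
    fderiv ℝ (fderiv ℝ (f ∘ (extChartAt (𝓡 n).tangent u).symm))
        (extChartAt (𝓡 n).tangent u u) v w =
    fderiv ℝ (fderiv ℝ (f ∘ (extChartAt (𝓡 n).tangent u).symm))
        (extChartAt (𝓡 n).tangent u u) w v :=
  ((hf.contDiffAt hu).isSymmSndFDerivAt (by simpa using ENat.LEInfty.out)) v w

lemma SmoothFun.isDJClosed_dJFun {f : TM n M → ℝ} (hf : SmoothFun f) : IsDJClosed (dJFun f) := by
  intro u hu v w
  rw [(isSemiBasic_dJFun f).dJOne_apply hu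
    ((hf.smoothOneForm_dJFun.contDiffAt hu).differentiableAt (by simp)),
    hf.fderiv_chartRep_dJFun hu, hf.fderiv_chartRep_dJFun hu, hf.fderiv_fderiv_symm hu, sub_self]

/-- Euler's identity in a chart. -/
lemma IsHomogFun.fderiv_chart {f : TM n M → ℝ} {k : ℤ} (hk : IsHomogFun k f) (hf : SmoothFun f)
    {u : TM n M} (hu : u ∈ slit n M) :
    (fun z : ModelTM n => fderiv ℝ (f ∘ (extChartAt (𝓡 n).tangent u).symm) z (0, z.2))
      =ᶠ[𝓝 (extChartAt (𝓡 n).tangent u u)]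
      fun z => k * (f ∘ (extChartAt (𝓡 n).tangent u).symm) z := by
  filter_upwards [hf.eventually_differentiableAt hu,
    (isOpen_slitTarget u).mem_nhds (extChartAt_self_mem_slitTarget hu)] with z hz hzt
  have hq := (extChartAt (𝓡 n).tangent u).map_target hzt.1
  have hr := (extChartAt (𝓡 n).tangent u).right_inv hzt.1
  have h1 := hk.dFun_liouville hf (symm_mem_slit hzt)
  rw [dFun_apply hq (by rwa [hr]), dchart_liouville u _ hq, hr] at h1
  exact h1

lemma IsHomogFun.isHomogOneForm_dJFun {f : TM n M → ℝ} {k : ℤ} (hk : IsHomogFun k f)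
    (hf : SmoothFun f) : IsHomogOneForm (k - 1) (dJFun f) := by
  intro u hu v
  have hsrc := mem_extChartAt_source (I := (𝓡 n).tangent) u
  have hd := hf.eventually_differentiableAt hu |>.self_of_nhds
  rw [(isSemiBasic_dJFun f).lieDerivOne_liouville hu
    ((hf.smoothOneForm_dJFun.contDiffAt hu).differentiableAt (by simp)),
    hf.fderiv_chartRep_dJFun hu, hf.fderiv_fderiv_symm hu]
  have h1 : dJFun f u v = _ := dFun_apply hsrc hd (J u v)
  rw [dchart_J u u hsrc] at h1
  rw [h1]
  generalize (dchart u u v).1 = a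
  have hs : HasFDerivAt (fun z : ModelTM n => ((0, z.2) : ModelTM n))
      ((0 : ModelTM n →L[ℝ] EuclideanSpace ℝ (Fin n)).prod (ContinuousLinearMap.snd ℝ _ _))
      (extChartAt (𝓡 n).tangent u u) :=
    (hasFDerivAt_const _ _).prodMk hasFDerivAt_snd
  -- `h2` and `h3` differentiate the two sides of Euler's identity; comparing them along `(0, a)`
  -- gives `h4`.
  have h2 := ((hf.contDiffAt_fderiv hu).differentiableAt (by simp)).hasFDerivAt.clm_apply hs
  have h3 := (hd.hasFDerivAt.const_mul (k : ℝ)).congr_of_eventuallyEq (hk.fderiv_chart hf hu)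
  have h4 : fderiv ℝ (f ∘ (extChartAt (𝓡 n).tangent u).symm) (extChartAt (𝓡 n).tangent u u)
        (0, a) + fderiv ℝ (fderiv ℝ (f ∘ (extChartAt (𝓡 n).tangent u).symm))
          (extChartAt (𝓡 n).tangent u u) (0, a) (0, (extChartAt (𝓡 n).tangent u u).2) =
      k * fderiv ℝ (f ∘ (extChartAt (𝓡 n).tangent u).symm) (extChartAt (𝓡 n).tangent u u) (0, a) :=
    DFunLike.congr_fun (h2.unique h3) ((0, a) : ModelTM n)
  push_cast
  linear_combination h4

/-! ### Homogeneous `d_J`-closed forms are `d_J`-exact -/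

lemma J_eq_liouville_iff (u q : TM n M) (hq : q ∈ (extChartAt (𝓡 n).tangent u).source)
    (ξ : TTM q) :
    J q ξ = liouville q ↔ (dchart u q ξ).1 = (extChartAt (𝓡 n).tangent u q).2 := by
  rw [← (dchart_injective u q hq).eq_iff, dchart_J u q hq, dchart_liouville u q hq]
  simp only [Prod.mk.injEq, true_and]

lemma dchart_surjective (u : TM n M) (v : ModelTM n) : ∃ ξ : TTM u, dchart u u ξ = v :=
  (isInvertible_mfderiv_extChartAt (mem_extChartAt_source (I := (𝓡 n).tangent) u)).surjective v

lemma exists_J_eq_liouville (u : TM n M) : ∃ ξ : TTM u, J u ξ = liouville u := by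
  obtain ⟨ξ, hξ⟩ := dchart_surjective u ((extChartAt (𝓡 n).tangent u u).2, 0)
  exact ⟨ξ, (J_eq_liouville_iff u u (mem_extChartAt_source _) ξ).2 (congrArg Prod.fst hξ)⟩

/-- `L` is `k⁻¹ i_S θ` for some, not necessarily smooth, vector field `S` with `J S = ℂ`. -/
def IsPotential (k : ℤ) (θ : OneForm n M) (L : TM n M → ℝ) : Prop :=
  ∀ u ∈ slit n M, ∃ ξ : TTM u, J u ξ = liouville u ∧ L u = (1 / (k : ℝ)) * θ u ξ

/-- A pointwise choice suffices: two solutions of `J ξ = ℂ` differ by a vertical vector, on which a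
semi-basic form vanishes. No global spray has to be constructed. -/
lemma exists_isPotential (k : ℤ) (θ : OneForm n M) : ∃ L, IsPotential k θ L := by
  choose S hS using exists_J_eq_liouville (n := n) (M := M)
  exact ⟨fun u => (1 / (k : ℝ)) * θ u (S u), fun u _ => ⟨S u, hS u, rfl⟩⟩

variable {k : ℤ} {θ : OneForm n M} {L : TM n M → ℝ}

/-- The vertical part of `ξ` does not contribute and its horizontal part is `y`. The formula no
longer mentions `ξ`, so `L` inherits smoothness from `θ`. -/
lemma IsPotential.chart_eventuallyEq (hL : IsPotential k θ L) (hs : IsSemiBasic θ) {u : TM n M}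
    (hu : u ∈ slit n M) :
    L ∘ (extChartAt (𝓡 n).tangent u).symm =ᶠ[𝓝 (extChartAt (𝓡 n).tangent u u)]
      fun z => (1 / (k : ℝ)) * chartRep θ u z (z.2, 0) := by
  filter_upwards [(isOpen_slitTarget u).mem_nhds (extChartAt_self_mem_slitTarget hu)] with z hz
  have hq := (extChartAt (𝓡 n).tangent u).map_target hz.1
  have hr := (extChartAt (𝓡 n).tangent u).right_inv hz.1
  obtain ⟨ξ, hξ, hLξ⟩ := hL _ (symm_mem_slit hz)
  rw [J_eq_liouville_iff u _ hq, hr] at hξ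
  refine hLξ.trans (congrArg _ ?_)
  rw [apply_eq_chartRep θ hq, hr]
  have hsplit : ∀ v : ModelTM n, v = (v.1, 0) + (0, v.2) := fun v => by simp
  rw [hsplit (dchart u _ ξ), map_add, chartRep_vertical hs u hz, add_zero, hξ]

lemma IsPotential.smoothFun (hL : IsPotential k θ L) (hθ : SmoothOneForm θ)
    (hs : IsSemiBasic θ) : SmoothFun L :=
  smoothFun_of_contDiffAt fun _ hu =>
    (contDiffAt_const.mul ((hθ.contDiffAt hu).clm_apply
      (contDiffAt_snd.prodMk contDiffAt_const))).congr_of_eventuallyEq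
      (hL.chart_eventuallyEq hs hu)

lemma IsPotential.eq_dJFun (hL : IsPotential k θ L) (hk : k ≠ 0) (hθ : SmoothOneForm θ)
    (hs : IsSemiBasic θ) (hh : IsHomogOneForm (k - 1) θ) (hc : IsDJClosed θ) {u : TM n M}
    (hu : u ∈ slit n M) : θ u = dJFun L u := by
  have hsrc := mem_extChartAt_source (I := (𝓡 n).tangent) u
  have hd := (hθ.contDiffAt hu).differentiableAt (by simp)
  have hLd := ((hL.smoothFun hθ hs).contDiffAt hu).differentiableAt (by simp)
  refine ContinuousLinearMap.ext fun ξ => ?_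
  have h1 : dJFun L u ξ = _ := dFun_apply hsrc hLd (J u ξ)
  rw [dchart_J u u hsrc] at h1
  have hpair : HasFDerivAt (fun z : ModelTM n => ((z.2, 0) : ModelTM n))
      ((ContinuousLinearMap.snd ℝ _ _).prod (0 : ModelTM n →L[ℝ] EuclideanSpace ℝ (Fin n)))
      (extChartAt (𝓡 n).tangent u u) :=
    hasFDerivAt_snd.prodMk (hasFDerivAt_const _ _)
  have h2 := ((hd.hasFDerivAt.clm_apply hpair).const_mul (1 / (k : ℝ))).congr_of_eventuallyEq
    (hL.chart_eventuallyEq hs hu)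
  -- With `η = (y, 0)`, closedness on the pair `(ξ, η)` trades the derivative of `θ(y, 0)` along
  -- `(0, a)` for the derivative of `θ(ξ)` along `ℂ`, which homogeneity evaluates; here `a` is the
  -- horizontal part of `ξ`.
  obtain ⟨η, hη⟩ := dchart_surjective u ((extChartAt (𝓡 n).tangent u u).2, 0)
  have h3 := hc u hu ξ η
  rw [hs.dJOne_apply hu hd, hη] at h3
  have h4 := hh u hu ξ
  rw [hs.lieDerivOne_liouville hu hd] at h4
  have h5 : θ u ξ = chartRep θ u (extChartAt (𝓡 n).tangent u u) ((dchart u u ξ).1, 0) := by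
    have hsplit : ∀ v : ModelTM n, v = (v.1, 0) + (0, v.2) := fun v => by simp
    rw [apply_eq_chartRep θ hsrc, hsplit (dchart u u ξ), map_add,
      chartRep_vertical hs u (extChartAt_self_mem_slitTarget hu), add_zero]
    simp
  have h6 : fderiv ℝ (L ∘ (extChartAt (𝓡 n).tangent u).symm) (extChartAt (𝓡 n).tangent u u)
      (0, (dchart u u ξ).1) = (1 / (k : ℝ)) *
        (chartRep θ u (extChartAt (𝓡 n).tangent u u) ((dchart u u ξ).1, 0) +
        fderiv ℝ (chartRep θ u) (extChartAt (𝓡 n).tangent u u) (0, (dchart u u ξ).1)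
          ((extChartAt (𝓡 n).tangent u u).2, 0)) :=
    DFunLike.congr_fun h2.fderiv ((0, (dchart u u ξ).1) : ModelTM n)
  -- What remains is `θ(ξ) = (1/k) (θ(ξ) + (k - 1) θ(ξ))`.
  rw [h1, h6, ← h5, sub_eq_zero.1 h3, h4]
  have hk' : (k : ℝ) ≠ 0 := by exact_mod_cast hk
  push_cast
  field_simp
  ring

lemma IsPotential.dFun_liouville (hL : IsPotential k θ L) (hk : k ≠ 0) {f : TM n M → ℝ}
    (hf : ∀ u ∈ slit n M, θ u = dJFun f u) {u : TM n M} (hu : u ∈ slit n M) :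
    dFun f u (liouville u) = k * L u := by
  obtain ⟨ξ, hξ, hLξ⟩ := hL u hu
  have hk' : (k : ℝ) ≠ 0 := by exact_mod_cast hk
  have h : θ u ξ = dFun f u (J u ξ) := DFunLike.congr_fun (hf u hu) ξ
  rw [hLξ, h, hξ]
  field_simp

end SlitTangent

end

open SlitTangent in
theorem mainTheorem5 (n : ℕ) (M : Type*) [TopologicalSpace M] [T2Space M]
    [SecondCountableTopology M] [ChartedSpace (EuclideanSpace ℝ (Fin n)) M]
    [IsManifold (𝓡 n) ∞ M] (k : ℤ) :
    (∀ L : SlitTangent.TM n M → ℝ,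
      SlitTangent.SmoothFun L → SlitTangent.IsHomogFun k L →
        SlitTangent.SmoothOneForm (SlitTangent.dJFun L) ∧
        SlitTangent.IsSemiBasic (SlitTangent.dJFun L) ∧
        SlitTangent.IsDJClosed (SlitTangent.dJFun L) ∧
        SlitTangent.IsHomogOneForm (k - 1) (SlitTangent.dJFun L)) ∧
    (k ≠ 0 → ∀ θ : SlitTangent.OneForm n M,
      SlitTangent.SmoothOneForm θ → SlitTangent.IsSemiBasic θ →
      SlitTangent.IsHomogOneForm (k - 1) θ → SlitTangent.IsDJClosed θ →
        SlitTangent.IsDJExact θ ∧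
        ∀ S : SlitTangent.VField n M, SlitTangent.IsSpray S →
          ∀ L : SlitTangent.TM n M → ℝ,
            (∀ u ∈ SlitTangent.slit n M, L u = (1 / (k : ℝ)) * SlitTangent.iField S θ u) →
            SlitTangent.SmoothFun L ∧ SlitTangent.IsHomogFun k L ∧
            (∀ u ∈ SlitTangent.slit n M, θ u = SlitTangent.dJFun L u) ∧
            ∀ L' : SlitTangent.TM n M → ℝ,
              SlitTangent.SmoothFun L' → SlitTangent.IsHomogFun k L' →
              (∀ u ∈ SlitTangent.slit n M, θ u = SlitTangent.dJFun L' u) →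
              EqOn L' L (SlitTangent.slit n M)) := by
  refine ⟨fun L hL hk => ⟨hL.smoothOneForm_dJFun, isSemiBasic_dJFun L, hL.isDJClosed_dJFun,
    hk.isHomogOneForm_dJFun hL⟩, fun hk θ hθ hs hh hc => ⟨?_, fun S hS L hLS => ?_⟩⟩
  -- Exactness is claimed with no spray given, so the pointwise potential is used.
  · obtain ⟨L, hL⟩ := exists_isPotential k θ
    exact ⟨L, hL.smoothFun hθ hs, fun u hu => hL.eq_dJFun hk hθ hs hh hc hu⟩
  · have hL : IsPotential k θ L := fun u hu => ⟨S u, hS.1.2 u hu, hLS u hu⟩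
    have hsm := hL.smoothFun hθ hs
    have hex : ∀ u ∈ slit n M, θ u = dJFun L u := fun u hu => hL.eq_dJFun hk hθ hs hh hc hu
    refine ⟨hsm, isHomogFun_of_dFun_liouville hsm fun u hu => hL.dFun_liouville hk hex hu, hex,
      fun L' hL' hk' hex' u hu => ?_⟩
    have hk0 : (k : ℝ) ≠ 0 := by exact_mod_cast hk
    exact mul_left_cancel₀ hk0
      ((hk'.dFun_liouville hL' hu).symm.trans (hL.dFun_liouville hk hex' hu))
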